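/- Let $\mathbb D$ be the open unit disc in $\mathbb C$. Let $D\subset\mathbb C^n$ be a domain that is balanced ($\lambda z\in D$ for all $z\in D$ and $\lambda\in\overline{\mathbb D}$) and taut (the family $\mathcal O(\mathbb D,D)$ of holomorphic maps $\mathbb D\to D$ is normal: every sequence in it has a subsequence that either converges locally uniformly on $\mathbb D$ to an element of $\mathcal O(\mathbb D,D)$ or is compactly divergent with respect to $D$). Let $h_D(z)=\inf\{t>0: z/t\in D\}$, $z\in\mathbb C^n$, be the Minkowski function of $D$, and let $\widehat h_D=h_{\widehat D}$ be that of the convex hull $\widehat D$ of $D$. For $z,w\in D$ let $$\tilde k_D(z,w)=\inf\{\tanh^{-1}|\alpha| : \alpha\in\mathbb D,\ \exists\,\varphi\in\mathcal O(\mathbb D,D):\ \varphi(0)=z,\ \varphi(\alpha)=w\}$$ be the Lempert function and, for an integer $m\ge 1$, let $$k_D^{(m)}(z,w)=\inf\Big\{\sum_{j=1}^m\tilde k_D(z_{j-1},z_j) : z_0,\dots,z_m\in D,\ z_0=z,\ z_m=w\Big\}$$ be the $m$-th Lempert function; put $(k_D^{(m)})^*=\tanh k_D^{(m)}$. Let $a\in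 D$, let $m\ge 1$ be an integer, and set $\mathbb D_{D,a}=\{\lambda a : \lambda\in\mathbb C,\ |\lambda|h_D(a)<1\}$. Then $$(k_D^{(m)})^*(0,\tilde a)=\widehat h_D(\tilde a)\ \text{ for all } \tilde a\in\mathbb D_{D,a}\iff h_D(a)=\widehat h_D(a).$$ -/

import Mathlib

open Set Filter Topology
open scoped ENNReal

noncomputable section

/-- The open unit disc `𝔻` of the complex plane. -/
def unitDisc : Set ℂ := Metric.ball 0 1

/-- `𝒪(𝔻, D)`: the maps that are holomorphic on the open unit disc and send it into `D`
(their values outside the disc are irrelevant). -/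
def holoDiscs {n : ℕ} (D : Set (EuclideanSpace ℂ (Fin n))) : Set (ℂ → EuclideanSpace ℂ (Fin n)) :=
  {φ | DifferentiableOn ℂ φ unitDisc ∧ MapsTo φ unitDisc D}

/-- A domain in `ℂⁿ`: a nonempty connected open set. -/
def IsDomainSet {n : ℕ} (D : Set (EuclideanSpace ℂ (Fin n))) : Prop :=
  IsOpen D ∧ IsConnected D

/-- `D` is taut: `𝒪(𝔻, D)` is a normal family, that is, every sequence in it has a subsequence that
either converges locally uniformly on `𝔻` to an element of `𝒪(𝔻, D)` or is compactly divergent. -/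
def IsTaut {n : ℕ} (D : Set (EuclideanSpace ℂ (Fin n))) : Prop :=
  ∀ φ : ℕ → ℂ → EuclideanSpace ℂ (Fin n), (∀ j, φ j ∈ holoDiscs D) →
    ∃ s : ℕ → ℕ, StrictMono s ∧
      ((∃ ψ ∈ holoDiscs D, TendstoLocallyUniformlyOn (fun j => φ (s j)) ψ atTop unitDisc) ∨
        (∀ K : Set ℂ, K ⊆ unitDisc → IsCompact K →
          ∀ L : Set (EuclideanSpace ℂ (Fin n)), L ⊆ D → IsCompact L →
            ∀ᶠ j in atTop, Disjoint (φ (s j) '' K) L))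

/-- The Lempert function of `D`: the infimum of `tanh⁻¹ |α|` over all `α ∈ 𝔻` for which some
`φ ∈ 𝒪(𝔻, D)` has `φ 0 = z` and `φ α = w`. It takes values in `[0, ∞]`, so that an infimum over the
empty set is `∞`. -/
def lempert {n : ℕ} (D : Set (EuclideanSpace ℂ (Fin n))) (z w : EuclideanSpace ℂ (Fin n)) : ℝ≥0∞ :=
  ⨅ (α : ℂ) (_ : α ∈ unitDisc ∧ ∃ φ ∈ holoDiscs D, φ 0 = z ∧ φ α = w),
    ENNReal.ofReal (Real.artanh ‖α‖)

/-- The `m`-th Lempert function of `D`: the infimum of the sums of the Lempert function along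
chains `z = z₀, z₁, …, z_m = w` of points of `D`. -/
def lempertChain {n : ℕ} (m : ℕ) (D : Set (EuclideanSpace ℂ (Fin n)))
    (z w : EuclideanSpace ℂ (Fin n)) : ℝ≥0∞ :=
  ⨅ (p : Fin (m + 1) → EuclideanSpace ℂ (Fin n))
    (_ : (∀ j, p j ∈ D) ∧ p 0 = z ∧ p (Fin.last m) = w),
    ∑ j : Fin m, lempert D (p j.castSucc) (p j.succ)

/-- The hyperbolic tangent on `[0, ∞]`, with `tanh ∞ = 1`. -/
def tanhStar (x : ℝ≥0∞) : ℝ := if x = ∞ then 1 else Real.tanh x.toReal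

/-- The Minkowski function `h_D(z) = inf {t > 0 : z / t ∈ D}`. -/
def minkowski {n : ℕ} (D : Set (EuclideanSpace ℂ (Fin n))) (z : EuclideanSpace ℂ (Fin n)) : ℝ :=
  gauge D z

/-- The Minkowski function of the convex hull of `D`. -/
def minkowskiHull {n : ℕ} (D : Set (EuclideanSpace ℂ (Fin n))) (z : EuclideanSpace ℂ (Fin n)) : ℝ :=
  minkowski (convexHull ℝ D) z

/-- The slice `{c • a : |c| h_D(a) < 1}`. -/
def slice {n : ℕ} (D : Set (EuclideanSpace ℂ (Fin n))) (a : EuclideanSpace ℂ (Fin n)) :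
    Set (EuclideanSpace ℂ (Fin n)) :=
  {x | ∃ c : ℂ, ‖c‖ * minkowski D a < 1 ∧ x = c • a}

end

/-! On `D` the `m`-th function lies above `minkowskiHull`: Hahn–Banach gives a complex-linear `F`
with `‖F‖ < 1` on `D` and `‖F b‖ = minkowskiHull D b`, and Schwarz–Pick for `F ∘ φ` bounds each link
of a chain. It lies below `minkowski` because of the linear discs `ζ ↦ (ζ / t) • b`. If the two
Minkowski functions agree at `a`, homogeneity makes them agree on the slice and the sandwich closes.
Conversely, if the hull's function were strictly smaller at `a`, the assumed equality would keep
`lempertChain m D 0` bounded on `t • a` as `t` increases to `1 / minkowski D a`. Tautness then puts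
the limit point in `D`, although its Minkowski function equals `1` and `D` is open. -/

open ComplexConjugate

/-! ### The hyperbolic tangent and its inverse -/

/-- The hypothesis is `x ≤ (c + r) / (1 + c * r)`, the addition law of `tanh`, with the denominator
cleared. -/
lemma artanh_le_add {x c r : ℝ} (hx₀ : 0 ≤ x) (hx : x < 1) (hc₀ : 0 ≤ c) (hc : c < 1)
    (hr₀ : 0 ≤ r) (hr : r < 1) (h : x * (1 + c * r) ≤ c + r) :
    Real.artanh x ≤ Real.artanh c + Real.artanh r := by
  rw [Real.artanh_eq_half_log ⟨by linarith, hx.le⟩, Real.artanh_eq_half_log ⟨by linarith, hc.le⟩,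
    Real.artanh_eq_half_log ⟨by linarith, hr.le⟩, ← mul_add]
  have h1 : 0 < 1 - x := by linarith
  have h2 : 0 < 1 - c := by linarith
  have h3 : 0 < 1 - r := by linarith
  rw [← Real.log_mul (by positivity) (by positivity)]
  refine mul_le_mul_of_nonneg_left (Real.log_le_log (by positivity) ?_) (by norm_num)
  rw [div_mul_div_comm, div_le_div_iff₀ h1 (by positivity)]
  linarith

lemma tanh_le_tanh_of_le {x y : ℝ} (h : x ≤ y) : Real.tanh x ≤ Real.tanh y := by
  rw [← Real.artanh_le_artanh_iff ⟨Real.neg_one_lt_tanh x, Real.tanh_lt_one x⟩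
    ⟨Real.neg_one_lt_tanh y, Real.tanh_lt_one y⟩, Real.artanh_tanh, Real.artanh_tanh]
  exact h

lemma tanhStar_mono {x y : ℝ≥0∞} (h : x ≤ y) : tanhStar x ≤ tanhStar y := by
  unfold tanhStar
  by_cases hy : y = ∞
  · rw [if_pos hy]
    split_ifs
    · exact le_rfl
    · exact (Real.tanh_lt_one _).le
  · have hx : x ≠ ∞ := ne_top_of_le_ne_top hy h
    rw [if_neg hy, if_neg hx]
    exact tanh_le_tanh_of_le (ENNReal.toReal_mono hy h)

lemma tanhStar_ofReal_artanh {t : ℝ} (h₀ : 0 ≤ t) (h₁ : t < 1) :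
    tanhStar (ENNReal.ofReal (Real.artanh t)) = t := by
  rw [tanhStar, if_neg ENNReal.ofReal_ne_top, ENNReal.toReal_ofReal (Real.artanh_nonneg h₀),
    Real.tanh_artanh ⟨by linarith, h₁⟩]

lemma eq_ofReal_artanh_tanhStar {x : ℝ≥0∞} (h : tanhStar x < 1) :
    x = ENNReal.ofReal (Real.artanh (tanhStar x)) := by
  have hx : x ≠ ∞ := by
    rintro rfl
    simp [tanhStar] at h
  rw [tanhStar, if_neg hx, Real.artanh_tanh, ENNReal.ofReal_toReal hx]

/-! ### The Schwarz–Pick lemma -/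

lemma norm_one_sub_conj_mul_sq_sub (c w : ℂ) :
    ‖1 - conj c * w‖ ^ 2 - ‖w - c‖ ^ 2 = (1 - ‖c‖ ^ 2) * (1 - ‖w‖ ^ 2) := by
  simp only [Complex.sq_norm, Complex.normSq_apply, Complex.sub_re, Complex.sub_im, Complex.mul_re,
    Complex.mul_im, Complex.conj_re, Complex.conj_im, Complex.one_re, Complex.one_im]
  ring

lemma norm_sub_lt_norm_one_sub_conj_mul {c w : ℂ} (hc : ‖c‖ < 1) (hw : ‖w‖ < 1) :
    ‖w - c‖ < ‖1 - conj c * w‖ := by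
  have h := norm_one_sub_conj_mul_sq_sub c w
  have hc' : 0 < 1 - ‖c‖ ^ 2 := by nlinarith [norm_nonneg c]
  have hw' : 0 < 1 - ‖w‖ ^ 2 := by nlinarith [norm_nonneg w]
  refine lt_of_pow_lt_pow_left₀ 2 (norm_nonneg _) ?_
  have := mul_pos hc' hw'
  linarith

/-- Replacing `c` and `w` by their moduli cannot increase the pseudohyperbolic distance: the right
side of `norm_one_sub_conj_mul_sq_sub` is unchanged and `‖1 - conj c * w‖` can only shrink. -/
lemma norm_sub_norm_le_of_norm_sub_le {c w : ℂ} {r : ℝ} (hr₀ : 0 ≤ r) (hr : r ≤ 1)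
    (hc : ‖c‖ < 1) (hw : ‖w‖ < 1) (h : ‖w - c‖ ≤ r * ‖1 - conj c * w‖) :
    ‖w‖ - ‖c‖ ≤ r * (1 - ‖c‖ * ‖w‖) := by
  have hid := norm_one_sub_conj_mul_sq_sub c w
  have hcw : 0 < 1 - ‖c‖ * ‖w‖ := by nlinarith [norm_nonneg c, norm_nonneg w]
  have hge : 1 - ‖c‖ * ‖w‖ ≤ ‖1 - conj c * w‖ := by
    have := norm_sub_norm_le (1 : ℂ) (conj c * w)
    rwa [norm_one, norm_mul, RCLike.norm_conj] at this
  have hsq : (1 - ‖c‖ * ‖w‖) ^ 2 ≤ ‖1 - conj c * w‖ ^ 2 := pow_le_pow_left₀ hcw.le hge 2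
  have hsq' : ‖w - c‖ ^ 2 ≤ r ^ 2 * ‖1 - conj c * w‖ ^ 2 := by
    rw [← mul_pow]
    exact pow_le_pow_left₀ (norm_nonneg _) h 2
  have hr2 : 0 ≤ 1 - r ^ 2 := by nlinarith
  refine le_of_sq_le_sq ?_ (by positivity)
  nlinarith [mul_le_mul_of_nonneg_left hsq hr2]

lemma norm_mul_one_add_le_of_mapsTo_unitDisc {g : ℂ → ℂ} (hg : DifferentiableOn ℂ g unitDisc)
    (hmaps : MapsTo g unitDisc unitDisc) {α : ℂ} (hα : α ∈ unitDisc) :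
    ‖g α‖ * (1 + ‖g 0‖ * ‖α‖) ≤ ‖g 0‖ + ‖α‖ := by
  have hlt : ∀ ζ ∈ unitDisc, ‖g ζ‖ < 1 := fun ζ hζ => mem_ball_zero_iff.1 (hmaps hζ)
  have h0 : ‖g 0‖ < 1 := hlt 0 (Metric.mem_ball_self one_pos)
  have hpick : ∀ ζ ∈ unitDisc, ‖g ζ - g 0‖ < ‖1 - conj (g 0) * g ζ‖ := fun ζ hζ =>
    norm_sub_lt_norm_one_sub_conj_mul h0 (hlt ζ hζ)
  have hpos : ∀ ζ ∈ unitDisc, 0 < ‖1 - conj (g 0) * g ζ‖ := fun ζ hζ =>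
    (norm_nonneg _).trans_lt (hpick ζ hζ)
  have hα1 : ‖α‖ < 1 := mem_ball_zero_iff.1 hα
  -- Schwarz's lemma for `g` followed by the disc automorphism sending `g 0` to `0`.
  have key : ‖(g α - g 0) / (1 - conj (g 0) * g α)‖ ≤ ‖α‖ := by
    refine Complex.norm_le_norm_of_mapsTo_ball
      (f := fun ζ => (g ζ - g 0) / (1 - conj (g 0) * g ζ)) (R := 1) ?_ ?_ (by simp) hα1
    · exact (hg.sub_const _).div ((hg.const_mul _).const_sub _)
        fun ζ hζ => norm_pos_iff.1 (hpos ζ hζ)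
    · intro ζ hζ
      rw [mem_closedBall_zero_iff, norm_div]
      exact (div_le_one (hpos ζ hζ)).2 (hpick ζ hζ).le
  rw [norm_div, div_le_iff₀ (hpos α hα)] at key
  have := norm_sub_norm_le_of_norm_sub_le (norm_nonneg α) hα1.le h0 (hlt α hα) key
  linarith

/-! ### Comparison of the Lempert functions with the Minkowski functions -/

section Bounds

variable {n : ℕ} {D : Set (EuclideanSpace ℂ (Fin n))}

lemma ofReal_artanh_le_add_lempert (F : StrongDual ℂ (EuclideanSpace ℂ (Fin n)))
    (hF : ∀ x ∈ D, ‖F x‖ < 1) {z w : EuclideanSpace ℂ (Fin n)} :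
    ENNReal.ofReal (Real.artanh ‖F w‖) ≤
      ENNReal.ofReal (Real.artanh ‖F z‖) + lempert D z w := by
  unfold lempert
  simp only [ENNReal.add_iInf]
  refine le_iInf₂ ?_
  rintro α ⟨hα, φ, ⟨hφ, hφD⟩, rfl, rfl⟩
  have hα1 : ‖α‖ < 1 := mem_ball_zero_iff.1 hα
  rw [← ENNReal.ofReal_add (Real.artanh_nonneg (norm_nonneg _)) (Real.artanh_nonneg (norm_nonneg _))]
  refine ENNReal.ofReal_le_ofReal ?_
  refine artanh_le_add (norm_nonneg _) (hF _ (hφD hα)) (norm_nonneg _)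
    (hF _ (hφD (Metric.mem_ball_self one_pos))) (norm_nonneg _) hα1 ?_
  exact norm_mul_one_add_le_of_mapsTo_unitDisc (g := fun ζ => F (φ ζ))
    (F.differentiable.comp_differentiableOn hφ)
    (fun ζ hζ => mem_ball_zero_iff.2 (hF _ (hφD hζ))) hα

lemma ENNReal.le_add_sum_of_le_add : ∀ {m : ℕ} (f : Fin (m + 1) → ℝ≥0∞) (g : Fin m → ℝ≥0∞),
    (∀ j, f j.succ ≤ f j.castSucc + g j) → f (Fin.last m) ≤ f 0 + ∑ j, g j
  | 0, f, g, _ => by simp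
  | m + 1, f, g, h => by
    have ih := ENNReal.le_add_sum_of_le_add (fun j => f j.castSucc) (fun j => g j.castSucc)
      fun j => h j.castSucc
    rw [Fin.sum_univ_castSucc, ← add_assoc]
    exact (h (Fin.last m)).trans (add_le_add_left ih _)

lemma ofReal_artanh_le_lempertChain (F : StrongDual ℂ (EuclideanSpace ℂ (Fin n)))
    (hF : ∀ x ∈ D, ‖F x‖ < 1) (m : ℕ) (b : EuclideanSpace ℂ (Fin n)) :
    ENNReal.ofReal (Real.artanh ‖F b‖) ≤ lempertChain m D 0 b := by
  refine le_iInf₂ ?_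
  rintro p ⟨-, hp0, rfl⟩
  have := ENNReal.le_add_sum_of_le_add (fun j => ENNReal.ofReal (Real.artanh ‖F (p j)‖)) _
    fun j => ofReal_artanh_le_add_lempert F hF (z := p j.castSucc) (w := p j.succ)
  simpa [hp0] using this

lemma zero_mem_of_isDomainSet (hD : IsDomainSet D) (hbal : Balanced ℂ D) : 0 ∈ D :=
  hbal.zero_mem hD.2.nonempty

lemma IsDomainSet.mem_nhds_zero (hD : IsDomainSet D) (hbal : Balanced ℂ D) : D ∈ 𝓝 0 :=
  hD.1.mem_nhds (zero_mem_of_isDomainSet hD hbal)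

lemma mem_of_minkowski_lt_one (hD : IsDomainSet D) (hbal : Balanced ℂ D)
    {x : EuclideanSpace ℂ (Fin n)} (hx : minkowski D x < 1) : x ∈ D := by
  obtain ⟨r, hr₀, hr, y, hy, rfl⟩ :=
    exists_lt_of_gauge_lt (absorbent_nhds_zero (hD.mem_nhds_zero hbal)) hx
  have := hbal.smul_mem (a := (r : ℂ)) (by simpa [abs_of_pos hr₀] using hr.le) hy
  simpa using this

lemma minkowski_nonneg (x : EuclideanSpace ℂ (Fin n)) : 0 ≤ minkowski D x := gauge_nonneg x

lemma minkowski_smul (hbal : Balanced ℂ D) (c : ℂ) (x : EuclideanSpace ℂ (Fin n)) :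
    minkowski D (c • x) = ‖c‖ * minkowski D x :=
  gauge_smul hbal c x

lemma balanced_convexHull (hbal : Balanced ℂ D) : Balanced ℂ (convexHull ℝ D) := by
  refine balanced_iff_smul_mem.2 fun {c} hc {x} hx => ?_
  -- The hull is real, but complex scaling is real-linear and so commutes with it.
  have hlin : IsLinearMap ℝ fun y : EuclideanSpace ℂ (Fin n) => c • y :=
    ⟨smul_add c, fun r y => smul_comm c r y⟩
  have h := mem_image_of_mem (fun y => c • y) hx
  rw [hlin.image_convexHull] at h
  exact convexHull_mono (image_subset_iff.2 fun y hy => hbal.smul_mem hc hy) h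

lemma minkowskiHull_smul (hbal : Balanced ℂ D) (c : ℂ) (x : EuclideanSpace ℂ (Fin n)) :
    minkowskiHull D (c • x) = ‖c‖ * minkowskiHull D x :=
  minkowski_smul (balanced_convexHull hbal) c x

lemma minkowskiHull_le_minkowski (hD : IsDomainSet D) (hbal : Balanced ℂ D)
    (x : EuclideanSpace ℂ (Fin n)) : minkowskiHull D x ≤ minkowski D x :=
  gauge_mono (absorbent_nhds_zero (hD.mem_nhds_zero hbal)) (subset_convexHull ℝ D) x

lemma smul_mem_of_norm_mul_minkowski_lt_one (hD : IsDomainSet D) (hbal : Balanced ℂ D) {c : ℂ}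
    {x : EuclideanSpace ℂ (Fin n)} (h : ‖c‖ * minkowski D x < 1) : c • x ∈ D :=
  mem_of_minkowski_lt_one hD hbal (by rwa [minkowski_smul hbal])

lemma lempert_self {z : EuclideanSpace ℂ (Fin n)} (hz : z ∈ D) : lempert D z z = 0 := by
  refine le_antisymm ?_ zero_le
  refine (iInf₂_le (0 : ℂ) ⟨Metric.mem_ball_self one_pos, fun _ => z,
    ⟨differentiableOn_const _, fun _ _ => hz⟩, rfl, rfl⟩).trans ?_
  simp

/-- Allowing any `t` above `minkowski D b` covers the case where the latter vanishes. -/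
lemma lempert_zero_le_ofReal_artanh (hD : IsDomainSet D) (hbal : Balanced ℂ D)
    {b : EuclideanSpace ℂ (Fin n)} {t : ℝ} (ht : minkowski D b ≤ t) (ht₀ : 0 < t) (ht₁ : t < 1) :
    lempert D 0 b ≤ ENNReal.ofReal (Real.artanh t) := by
  have hnorm : ‖(t : ℂ)‖ = t := by simp [abs_of_pos ht₀]
  have htc : (t : ℂ) ≠ 0 := by exact_mod_cast ht₀.ne'
  refine (iInf₂_le (t : ℂ) ⟨mem_ball_zero_iff.2 (by rwa [hnorm]), fun ζ => (ζ / t) • b,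
    ⟨?_, fun ζ hζ => ?_⟩, by simp, by simp [htc]⟩).trans (by rw [hnorm])
  · fun_prop
  · refine smul_mem_of_norm_mul_minkowski_lt_one hD hbal ?_
    have hζ1 : ‖ζ‖ < 1 := mem_ball_zero_iff.1 hζ
    rw [norm_div, hnorm, div_mul_eq_mul_div, div_lt_one ht₀]
    nlinarith [mul_le_mul_of_nonneg_left ht (norm_nonneg ζ)]

lemma lempertChain_le_lempert {m : ℕ} (hm : 1 ≤ m) {z w : EuclideanSpace ℂ (Fin n)} (hz : z ∈ D)
    (hw : w ∈ D) : lempertChain m D z w ≤ lempert D z w := by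
  obtain ⟨k, rfl⟩ := Nat.exists_eq_add_of_le' hm
  -- The chain `z, w, …, w`: only its first link has a cost.
  refine (iInf₂_le (Fin.cons z fun _ => w) ⟨Fin.cases (by simpa) (by simpa), by simp,
    by rw [← Fin.succ_last, Fin.cons_succ]⟩).trans ?_
  · rw [Fin.sum_univ_succ]
    simp only [Fin.castSucc_zero, Fin.cons_zero, Fin.cons_succ, Fin.castSucc_succ]
    simp [lempert_self hw]

lemma tanhStar_lempertChain_le_minkowski (hD : IsDomainSet D) (hbal : Balanced ℂ D) {m : ℕ}
    (hm : 1 ≤ m) {b : EuclideanSpace ℂ (Fin n)} (hb : minkowski D b < 1) :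
    tanhStar (lempertChain m D 0 b) ≤ minkowski D b := by
  refine le_of_forall_gt_imp_ge_of_dense fun t ht => ?_
  rcases le_or_gt 1 t with h1 | h1
  · exact (tanhStar_mono le_top).trans (by simpa [tanhStar] using h1)
  have ht₀ : 0 < t := (minkowski_nonneg b).trans_lt ht
  rw [← tanhStar_ofReal_artanh ht₀.le h1]
  exact tanhStar_mono ((lempertChain_le_lempert hm (zero_mem_of_isDomainSet hD hbal)
    (mem_of_minkowski_lt_one hD hbal hb)).trans
      (lempert_zero_le_ofReal_artanh hD hbal ht.le ht₀ h1))

/-- Hahn–Banach for the Minkowski function of the convex hull. -/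
lemma exists_strongDual_norm_eq_minkowskiHull (hD : IsDomainSet D) (hbal : Balanced ℂ D)
    (b : EuclideanSpace ℂ (Fin n)) :
    ∃ F : StrongDual ℂ (EuclideanSpace ℂ (Fin n)),
      (∀ x ∈ D, ‖F x‖ < 1) ∧ ‖F b‖ = minkowskiHull D b := by
  rcases (minkowski_nonneg (D := convexHull ℝ D) b).eq_or_lt' with h | h
  · exact ⟨0, by simp, by rw [zero_apply, norm_zero]; exact h.symm⟩
  set s := minkowskiHull D b with hs
  change 0 < s at h
  have hsc : (s : ℂ) ≠ 0 := by exact_mod_cast h.ne'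
  have hopen : IsOpen (convexHull ℝ D) := hD.1.convexHull
  have hnot : ((s : ℂ)⁻¹ • b) ∉ convexHull ℝ D := by
    intro hmem
    have h1 : minkowskiHull D ((s : ℂ)⁻¹ • b) < 1 := gauge_lt_one_of_mem_of_isOpen hopen hmem
    rw [minkowskiHull_smul hbal, norm_inv, Complex.norm_real, Real.norm_of_nonneg h.le, ← hs,
      inv_mul_cancel₀ h.ne'] at h1
    exact lt_irrefl _ h1
  obtain ⟨f, hf⟩ := RCLike.geometric_hahn_banach_open_point (𝕜 := ℂ) (convex_convexHull ℝ D)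
    hopen hnot
  set u := f ((s : ℂ)⁻¹ • b) with hu
  have hu0 : 0 < u.re := by
    simpa using hf 0 (subset_convexHull ℝ D (zero_mem_of_isDomainSet hD hbal))
  have hu1 : 0 < ‖u‖ := hu0.trans_le (Complex.re_le_norm u)
  have huc : (‖u‖ : ℂ) ≠ 0 := by exact_mod_cast hu1.ne'
  have hlt : ∀ x ∈ D, ‖f x‖ < ‖u‖ := by
    intro x hx
    -- A unimodular rotation, allowed since `D` is balanced, turns the bound on the real part into
    -- one on the modulus.
    obtain ⟨c, hc, hcx⟩ := RCLike.exists_norm_eq_mul_self (f x)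
    have := hf (c • x) (subset_convexHull ℝ D (hbal.smul_mem hc.le hx))
    rw [map_smul, smul_eq_mul, ← hcx] at this
    exact (show ‖f x‖ < u.re by simpa using this).trans_le (Complex.re_le_norm u)
  refine ⟨(‖u‖ : ℂ)⁻¹ • f, fun x hx => ?_, ?_⟩
  · rw [smul_apply, norm_smul, norm_inv, Complex.norm_real, norm_norm,
      inv_mul_lt_one₀ hu1]
    exact hlt x hx
  · have hfb : f b = s * u := by
      rw [hu, map_smul, smul_eq_mul, mul_inv_cancel_left₀ hsc]
    rw [smul_apply, norm_smul, norm_inv, Complex.norm_real, norm_norm, hfb,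
      norm_mul, Complex.norm_real, Real.norm_of_nonneg h.le]
    field_simp

lemma minkowskiHull_le_tanhStar_lempertChain (hD : IsDomainSet D) (hbal : Balanced ℂ D) (m : ℕ)
    {b : EuclideanSpace ℂ (Fin n)} (hb : b ∈ D) :
    minkowskiHull D b ≤ tanhStar (lempertChain m D 0 b) := by
  obtain ⟨F, hF, hFb⟩ := exists_strongDual_norm_eq_minkowskiHull hD hbal b
  rw [← hFb, ← tanhStar_ofReal_artanh (norm_nonneg (F b)) (hF b hb)]
  exact tanhStar_mono (ofReal_artanh_le_lempertChain F hF m b)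

/-! ### Compactness of Lempert balls in taut domains -/

lemma exists_holoDiscs_of_lempert_lt {z w : EuclideanSpace ℂ (Fin n)} {R : ℝ}
    (h : lempert D z w < ENNReal.ofReal R) :
    ∃ α : ℂ, ‖α‖ ≤ Real.tanh R ∧ ∃ φ ∈ holoDiscs D, φ 0 = z ∧ φ α = w := by
  simp only [lempert, iInf_lt_iff] at h
  obtain ⟨α, ⟨hα, hφ⟩, hlt⟩ := h
  refine ⟨α, ?_, hφ⟩
  have hα1 : ‖α‖ < 1 := mem_ball_zero_iff.1 hα
  rw [← Real.tanh_artanh (x := ‖α‖) ⟨by linarith [norm_nonneg α], hα1⟩]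
  exact tanh_le_tanh_of_le (ENNReal.lt_ofReal_iff_toReal_lt ENNReal.ofReal_ne_top |>.1 hlt |>.le
    |> fun h' => by rwa [ENNReal.toReal_ofReal (Real.artanh_nonneg (norm_nonneg α))] at h')

/-- Discs whose centres converge in `D` cannot diverge compactly, and the parameters `α k` stay in
the compact disc of radius `tanh R < 1`. The base point moves so that the lemma can be iterated
along chains. -/
lemma IsTaut.exists_subseq_tendsto_of_lempert_lt (htaut : IsTaut D)
    {z w : ℕ → EuclideanSpace ℂ (Fin n)} {z₀ : EuclideanSpace ℂ (Fin n)} {R : ℝ} (hz₀ : z₀ ∈ D)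
    (hzD : ∀ k, z k ∈ D) (hz : Tendsto z atTop (𝓝 z₀))
    (hR : ∀ k, lempert D (z k) (w k) < ENNReal.ofReal R) :
    ∃ s : ℕ → ℕ, StrictMono s ∧ ∃ w₀ ∈ D, Tendsto (fun k => w (s k)) atTop (𝓝 w₀) := by
  choose α hα φ hφ hφ0 hφα using fun k => exists_holoDiscs_of_lempert_lt (hR k)
  obtain ⟨s, hs, hconv | hdiv⟩ := htaut φ hφ
  · obtain ⟨ψ, hψ, hlim⟩ := hconv
    obtain ⟨β, hβ, t, ht, hβlim⟩ := (isCompact_closedBall (0 : ℂ) (Real.tanh R)).tendsto_subseq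
      (x := fun k => α (s k)) fun k => mem_closedBall_zero_iff.2 (hα (s k))
    have hβ1 : β ∈ unitDisc :=
      mem_ball_zero_iff.2 ((mem_closedBall_zero_iff.1 hβ).trans_lt (Real.tanh_lt_one R))
    have hαD : ∀ k, α k ∈ unitDisc := fun k =>
      mem_ball_zero_iff.2 ((hα k).trans_lt (Real.tanh_lt_one R))
    have hlim' : TendstoLocallyUniformlyOn (fun j => φ (s (t j))) ψ atTop unitDisc :=
      fun u hu x hx => by
        obtain ⟨v, hv, hev⟩ := hlim u hu x hx
        exact ⟨v, hv, ht.tendsto_atTop.eventually hev⟩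
    refine ⟨fun k => s (t k), hs.comp ht, ψ β, hψ.2 hβ1, ?_⟩
    have := hlim'.tendsto_comp (hψ.1.continuousOn β hβ1) hβ1
      (tendsto_nhdsWithin_iff.2 ⟨hβlim, Eventually.of_forall fun k => hαD (s (t k))⟩)
    simpa [hφα] using this
  · exfalso
    have hev := hdiv {0} (by simp [unitDisc]) isCompact_singleton (insert z₀ (range z))
      (insert_subset hz₀ (range_subset_iff.2 hzD)) hz.isCompact_insert_range
    obtain ⟨j, hj⟩ := hev.exists
    refine disjoint_left.1 hj (mem_image_of_mem _ rfl) ?_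
    rw [hφ0]
    exact Or.inr (mem_range_self _)

lemma IsTaut.exists_subseq_tendsto_of_lempertChain_lt (htaut : IsTaut D) {m : ℕ}
    {z₀ : EuclideanSpace ℂ (Fin n)} {w : ℕ → EuclideanSpace ℂ (Fin n)} {R : ℝ} (hz₀ : z₀ ∈ D)
    (hR : ∀ k, lempertChain m D z₀ (w k) < ENNReal.ofReal R) :
    ∃ s : ℕ → ℕ, StrictMono s ∧ ∃ w₀ ∈ D, Tendsto (fun k => w (s k)) atTop (𝓝 w₀) := by
  have hex : ∀ k, ∃ p : Fin (m + 1) → EuclideanSpace ℂ (Fin n),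
      ((∀ j, p j ∈ D) ∧ p 0 = z₀ ∧ p (Fin.last m) = w k) ∧
        ∑ j : Fin m, lempert D (p j.castSucc) (p j.succ) < ENNReal.ofReal R := fun k => by
    simpa only [lempertChain, iInf_lt_iff, exists_prop] using hR k
  choose p hp hpR using hex
  have hstep : ∀ k (j : Fin m), lempert D (p k j.castSucc) (p k j.succ) < ENNReal.ofReal R :=
    fun k j => (Finset.single_le_sum (f := fun j : Fin m =>
      lempert D (p k j.castSucc) (p k j.succ)) (fun _ _ => zero_le) (Finset.mem_univ j)).trans_lt
        (hpR k)
  -- Each vertex serves as the convergent base point for the next, after refining the subsequence.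
  have hall : ∀ j : Fin (m + 1), ∃ s : ℕ → ℕ, StrictMono s ∧ ∃ x ∈ D,
      Tendsto (fun k => p (s k) j) atTop (𝓝 x) := by
    intro j
    induction j using Fin.induction with
    | zero => exact ⟨id, strictMono_id, z₀, hz₀, by simp [(hp _).2.1]⟩
    | succ j ih =>
      obtain ⟨s, hs, x, hx, hlim⟩ := ih
      obtain ⟨t, ht, y, hy, hlim'⟩ := htaut.exists_subseq_tendsto_of_lempert_lt
        (w := fun k => p (s k) j.succ) hx (fun k => (hp (s k)).1 _) hlim fun k => hstep (s k) j
      exact ⟨fun k => s (t k), hs.comp ht, y, hy, hlim'⟩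
  obtain ⟨s, hs, x, hx, hlim⟩ := hall (Fin.last m)
  exact ⟨s, hs, x, hx, by simpa only [(hp _).2.2] using hlim⟩

/-- In a taut balanced domain the Lempert functions blow up along the radius through a point with
positive Minkowski function, so they cannot agree with a strictly smaller homogeneous function. -/
lemma IsTaut.minkowski_le_minkowskiHull (hD : IsDomainSet D) (hbal : Balanced ℂ D)
    (htaut : IsTaut D) {a : EuclideanSpace ℂ (Fin n)} {m : ℕ}
    (h : ∀ b ∈ slice D a, tanhStar (lempertChain m D 0 b) = minkowskiHull D b) :
    minkowski D a ≤ minkowskiHull D a := by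
  by_contra! hlt
  set H := minkowski D a with hH
  have hhat : 0 ≤ minkowskiHull D a := minkowski_nonneg a
  have hHpos : 0 < H := hhat.trans_lt hlt
  set q := minkowskiHull D a / H with hq
  have hq0 : 0 ≤ q := by positivity
  have hq1 : q < 1 := (div_lt_one hHpos).2 hlt
  let t : ℕ → ℝ := fun k => (1 - 1 / ((k : ℝ) + 1)) / H
  have ht0 : ∀ k, 0 ≤ t k := fun k => by
    have : 1 / ((k : ℝ) + 1) ≤ 1 := by
      rw [div_le_one (by positivity)]
      linarith [(k.cast_nonneg : (0 : ℝ) ≤ k)]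
    exact div_nonneg (by linarith) hHpos.le
  have ht1 : ∀ k, t k * H < 1 := fun k => by
    have : 0 < 1 / ((k : ℝ) + 1) := by positivity
    simp only [t]
    rw [div_mul_cancel₀ _ hHpos.ne']
    linarith
  have hnorm : ∀ k, ‖(t k : ℂ)‖ = t k := fun k => by
    rw [Complex.norm_real, Real.norm_of_nonneg (ht0 k)]
  have htlim : Tendsto t atTop (𝓝 (1 / H)) := by
    have := (tendsto_one_div_add_atTop_nhds_zero_nat (𝕜 := ℝ)).const_sub 1
    simpa only [sub_zero] using this.div_const H
  -- On these points the function has `tanh` at most `q < 1`; the `+ 1` makes the bound strict.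
  have hbound : ∀ k, lempertChain m D 0 ((t k : ℂ) • a) <
      ENNReal.ofReal (Real.artanh q + 1) := fun k => by
    have hval := h ((t k : ℂ) • a) ⟨t k, by rw [hnorm]; exact ht1 k, rfl⟩
    rw [minkowskiHull_smul hbal, hnorm] at hval
    have hle : t k * minkowskiHull D a ≤ q := by
      rw [hq, le_div_iff₀ hHpos]
      nlinarith [mul_le_mul_of_nonneg_right (ht1 k).le hhat]
    rw [eq_ofReal_artanh_tanhStar (hval.trans_lt (hle.trans_lt hq1)), hval,
      ENNReal.ofReal_lt_ofReal_iff (by linarith [Real.artanh_nonneg hq0])]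
    have := Real.artanh_le_artanh
      (by linarith [mul_nonneg (ht0 k) hhat] : -1 < t k * minkowskiHull D a) hq1 hle
    linarith
  obtain ⟨s, hs, x, hx, hlim⟩ := htaut.exists_subseq_tendsto_of_lempertChain_lt
    (zero_mem_of_isDomainSet hD hbal) hbound
  have hlim' : Tendsto (fun k => (t (s k) : ℂ) • a) atTop (𝓝 (((1 / H : ℝ) : ℂ) • a)) :=
    (((Complex.continuous_ofReal.tendsto _).comp (htlim.comp hs.tendsto_atTop)).smul_const a)
  rw [tendsto_nhds_unique hlim hlim'] at hx
  -- The limit `a / H` has Minkowski function exactly `1`, so it cannot lie in the open set `D`.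
  have hx1 : minkowski D (((1 / H : ℝ) : ℂ) • a) < 1 := gauge_lt_one_of_mem_of_isOpen hD.1 hx
  rw [minkowski_smul hbal, Complex.norm_real, Real.norm_of_nonneg (by positivity), ← hH,
    one_div_mul_cancel hHpos.ne'] at hx1
  exact lt_irrefl _ hx1

end Bounds

theorem proposition6 {n : ℕ} (D : Set (EuclideanSpace ℂ (Fin n))) (hD : IsDomainSet D)
    (hbal : Balanced ℂ D) (htaut : IsTaut D) (a : EuclideanSpace ℂ (Fin n)) (ha : a ∈ D)
    (m : ℕ) (hm : 1 ≤ m) :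
    (∀ b ∈ slice D a, tanhStar (lempertChain m D 0 b) = minkowskiHull D b) ↔
      minkowski D a = minkowskiHull D a := by
  refine ⟨fun h => le_antisymm (htaut.minkowski_le_minkowskiHull hD hbal h)
    (minkowskiHull_le_minkowski hD hbal a), fun h => ?_⟩
  rintro _ ⟨c, hc, rfl⟩
  refine le_antisymm ?_ (minkowskiHull_le_tanhStar_lempertChain hD hbal m
    (smul_mem_of_norm_mul_minkowski_lt_one hD hbal hc))
  rw [minkowskiHull_smul hbal, ← h, ← minkowski_smul hbal]
  exact tanhStar_lempertChain_le_minkowski hD hbal hm (by rwa [minkowski_smul hbal])
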